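/- Fix $P>0$, $0\le\epsilon<1$ and a base $b>1$ for the logarithm $\log$. For $n\ge 0$ the $n$-th use of the $AWGN(P)$ channel is the random transformation with input space $\mathcal X_n=\{x\in\mathbb R^n:\ \|x\|_2\le\sqrt{nP}\}$, output space $\mathbb R^n$ and transition kernel $P_{Y^n|X^n=x}=\mathcal N(x,\mathbf I_n)$. An $(n,M,\epsilon)_{max,det}$ code for it consists of an integer $M\ge1$, a deterministic encoder $\mathsf f:\{1,\dots,M\}\to\mathcal X_n$ and a (possibly randomized) decoder, i.e. a Markov kernel $\mathsf g$ from $\mathbb R^n$ to $\{1,\dots,M\}$, such that the maximal probability of error is at most $\epsilon$: for every $j\in\{1,\dots,M\}$, if $Y^n\sim\mathcal N(\mathsf f(j),\mathbf I_n)$ and $\hat W$ is the output of $\mathsf g$ on $Y^n$, then $\mathbb P[\hat W\ne j]\le\epsilon$. The output distribution $P_{Y^n}$ induced by the code is the law of the channel output $Y^n$ when the input is $X^n=\mathsf f(W)$ with $W$ equiprobable on $\{1,\dots,M\}$, and $p_{Y^n}$ is the density of $P_{Y^n}$ with respect to Lebesgue measure on $\mathbb R^n$. Theorem. There is a constant $a=a(\epsilon,P,b)$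 such that every sequence of $(n,M_n,\epsilon)_{max,det}$ codes ($n=0,1,2,\dots$) for the $AWGN(P)$ channel, with no assumption on the growth of $M_n$, satisfies, for all sufficiently large $n$, that $\log p_{Y^n}(Y^n)$ is square integrable and $$\operatorname{Var}\left[\log p_{Y^n}(Y^n)\right]\le a\,n .$$ In particular, for every such sequence the output AEP holds: $\operatorname{Var}\left[\log p_{Y^n}(Y^n)\right]=o(n^2)$ as $n\to\infty$. -/

import Mathlib

open MeasureTheory ProbabilityTheory Filter Asymptotics
open scoped ProbabilityTheory

noncomputable section

/-- A deterministic code with `M` messages and maximal probability of error at most `ε` for the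
random transformation `W : X → Y`: a (non-random) encoder, and a possibly randomized decoder.
The messages `1, …, M` are represented by `Fin M`. -/
structure MaxDetCode {X Y : Type*} [MeasurableSpace X] [MeasurableSpace Y]
    (W : Kernel X Y) (M : ℕ) (ε : ℝ) where
  /-- There is at least one message. -/
  card_pos : 0 < M
  /-- The encoder. -/
  encoder : Fin M → X
  /-- The decoder: given the channel output, the law of the decoded message. -/
  decoder : Kernel Y (Fin M)
  /-- The decoder is a random transformation. -/
  isMarkovKernel_decoder : IsMarkovKernel decoder
  /-- For each message `j`, the probability that the decoded message differs from `j`, when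
  `j` is sent, is at most `ε`. -/
  error_le : ∀ j : Fin M, ((decoder ∘ₖ W) (encoder j)).real {j}ᶜ ≤ ε

namespace MaxDetCode

variable {X Y : Type*} [MeasurableSpace X] [MeasurableSpace Y]
  {W : Kernel X Y} {M : ℕ} {ε : ℝ}

/-- The input distribution induced by the encoder: the law of `encoder w`, for a message `w`
which is equiprobable on the `M` messages. -/
def inputDist (c : MaxDetCode W M ε) : Measure X :=
  (uniformOn (Set.univ : Set (Fin M))).map c.encoder

/-- The output distribution induced by the encoder. -/
def outputDist (c : MaxDetCode W M ε) : Measure Y :=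
  W ∘ₘ c.inputDist

end MaxDetCode

/-- The input space of the `AWGN(P)` channel at blocklength `n`: the vectors of `ℝⁿ` of Euclidean
norm at most `√(nP)`. -/
abbrev AWGNInput (P : ℝ) (n : ℕ) : Type :=
  {x : EuclideanSpace ℝ (Fin n) // ‖x‖ ≤ √(n * P)}

theorem measurable_multivariateGaussian_mean (n : ℕ) :
    Measurable fun x : EuclideanSpace ℝ (Fin n) =>
      multivariateGaussian x (1 : Matrix (Fin n) (Fin n) ℝ) := by
  refine Measure.measurable_of_measurable_coe _ fun s hs => ?_
  have h : (fun x : EuclideanSpace ℝ (Fin n) =>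
        multivariateGaussian x (1 : Matrix (Fin n) (Fin n) ℝ) s) =
      fun x => stdGaussian (EuclideanSpace ℝ (Fin n))
        (Prod.mk x ⁻¹' ((fun p : EuclideanSpace ℝ (Fin n) × EuclideanSpace ℝ (Fin n) =>
          p.1 + p.2) ⁻¹' s)) := by
    funext x
    have hx : multivariateGaussian x (1 : Matrix (Fin n) (Fin n) ℝ) =
        (stdGaussian (EuclideanSpace ℝ (Fin n))).map (fun z => x + z) := by
      simp [multivariateGaussian]
    rw [hx, Measure.map_apply (by fun_prop) hs]
    rfl
  rw [h]
  exact measurable_measure_prodMk_left ((measurable_fst.add measurable_snd) hs)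

/-- The `AWGN(P)` channel at blocklength `n`: the input `x` is sent to the normal distribution on
`ℝⁿ` with mean `x` and identity covariance matrix. -/
def awgn (P : ℝ) (n : ℕ) : Kernel (AWGNInput P n) (EuclideanSpace ℝ (Fin n)) where
  toFun x := multivariateGaussian (x : EuclideanSpace ℝ (Fin n)) 1
  measurable' := (measurable_multivariateGaussian_mean n).comp measurable_subtype_coe

/-- The density, with respect to Lebesgue measure, of a distribution on `ℝⁿ`. -/
def lebesgueDensity {n : ℕ} (μ : Measure (EuclideanSpace ℝ (Fin n)))
    (y : EuclideanSpace ℝ (Fin n)) : ℝ :=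
  (μ.rnDeriv volume y).toReal

end

/-! ### A Poincaré inequality for Lipschitz functions of a standard Gaussian vector -/

/-! Conditionally on message `j`, the output is `x j + z` with `z` standard Gaussian, and its
log-density is a constant plus `mixtureLLR x j z` minus `‖z‖ ^ 2 / 2`. The variance of `‖z‖ ^ 2` is
linear in `n`. The log-likelihood ratio is a log-sum-exp of linear forms with slopes `x i - x j`,
hence Lipschitz with constant `2 √(nP)`; a Gaussian Poincaré inequality bounds its variance by a
multiple of `n`, whatever the number of codewords.

What remains is the spread over `j` of the conditional means `F j` of `mixtureLLR x j`, and only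
here is decodability used. Put `T j = log M + F j`. Keeping the `j`-th summand alone gives `T j ≥
0`. Conversely, the decoder is a test that accepts `j` with probability at least `δ = 1 - ε` under
the `j`-th component; since the log-likelihood ratio has standard deviation at most `σ = O(√n)`, the
mixture accepts `j` with probability at least `δ * exp (F j - σ / δ)`
(`mul_exp_le_integral_mul_exp`). These probabilities sum to one over `j`, so the average of `exp (T
j)` is at most `exp (σ / δ - log δ)`, which forces the average of `T j ^ 2` to be `O(n)`
(`mean_sq_log_add_integral_mixtureLLR_le`). The size of `M` cancels throughout. -/

theorem memLp_two_sq_of_memLp_four {Ω : Type*} [MeasurableSpace Ω] {μ : Measure Ω} {f : Ω → ℝ}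
    (hf : MemLp f 4 μ) : MemLp (fun ω => f ω ^ 2) 2 μ := by
  have : ENNReal.HolderTriple 4 4 2 := ⟨by
    rw [← two_mul, show (4 : ENNReal) = 2 * 2 by norm_num, ENNReal.mul_inv (by simp) (by simp),
      ← mul_assoc, ENNReal.mul_inv_cancel (by simp) (by simp), one_mul]⟩
  simpa only [sq] using! hf.mul (r := 2) hf

section Poincare

variable {E : Type*} [NormedAddCommGroup E] [InnerProductSpace ℝ E]

theorem hasDerivAt_comp_rotation {f : E → ℝ} (hf : ContDiff ℝ 1 f) (p : E × E) (θ : ℝ) :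
    HasDerivAt (fun θ : ℝ => f (ContinuousLinearMap.rotation θ p).1)
      (fderiv ℝ f (ContinuousLinearMap.rotation θ p).1 (ContinuousLinearMap.rotation θ p).2) θ := by
  have h1 : HasDerivAt (fun θ : ℝ => (ContinuousLinearMap.rotation θ p).1)
      (ContinuousLinearMap.rotation θ p).2 θ := by
    simp only [ContinuousLinearMap.rotation_apply]
    exact ((Real.hasDerivAt_cos θ).smul_const p.1).add ((Real.hasDerivAt_sin θ).smul_const p.2)
  exact ((hf.differentiable one_ne_zero).differentiableAt.hasFDerivAt).comp_hasDerivAt θ h1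

/-- Cauchy–Schwarz, from the nonnegativity of the integral of `(g - m) ^ 2`, with `m` the mean of
`g`. -/
theorem sq_intervalIntegral_le {g : ℝ → ℝ} (hg : Continuous g) {a b : ℝ} (hab : a ≤ b) :
    (∫ t in a..b, g t) ^ 2 ≤ (b - a) * ∫ t in a..b, g t ^ 2 := by
  rcases hab.eq_or_lt with rfl | hab
  · simp
  set m := (∫ t in a..b, g t) / (b - a) with hm
  have hI : ∫ t in a..b, g t = m * (b - a) := by
    rw [hm]; field_simp [(sub_pos.2 hab).ne']
  have h0 : 0 ≤ ∫ t in a..b, (g t - m) ^ 2 :=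
    intervalIntegral.integral_nonneg hab.le fun _ _ => sq_nonneg _
  have h1 : ∫ t in a..b, (g t - m) ^ 2
      = (∫ t in a..b, g t ^ 2) - 2 * m * (∫ t in a..b, g t) + m ^ 2 * (b - a) := by
    have : ∀ t, (g t - m) ^ 2 = g t ^ 2 - 2 * m * g t + m ^ 2 := fun t => by ring
    simp_rw [this]
    rw [intervalIntegral.integral_add, intervalIntegral.integral_sub,
      intervalIntegral.integral_const_mul, intervalIntegral.integral_const, smul_eq_mul]
    · ring
    all_goals exact Continuous.intervalIntegrable (by fun_prop) _ _
  rw [h1, hI] at h0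
  rw [hI]
  nlinarith [sub_pos.2 hab]

theorem continuous_rotation_uncurry :
    Continuous fun q : ℝ × (E × E) => ContinuousLinearMap.rotation q.1 q.2 := by
  simp only [ContinuousLinearMap.rotation_apply]
  fun_prop

/-- Rotating from angle `0` to `π / 2` moves the first coordinate from `p.1` to `p.2`, with velocity
equal to the second coordinate. The bound is the fundamental theorem of calculus along this path,
then Cauchy–Schwarz. -/
theorem sq_sub_le_integral_rotation {f : E → ℝ} (hf : ContDiff ℝ 1 f) (p : E × E) :
    (f p.1 - f p.2) ^ 2 ≤ Real.pi / 2 * ∫ θ in (0 : ℝ)..Real.pi / 2,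
      fderiv ℝ f (ContinuousLinearMap.rotation θ p).1 (ContinuousLinearMap.rotation θ p).2 ^ 2 := by
  have hR : Continuous fun θ : ℝ => ContinuousLinearMap.rotation θ p := by
    simp only [ContinuousLinearMap.rotation_apply]
    fun_prop
  have hc : Continuous fun θ : ℝ =>
      fderiv ℝ f (ContinuousLinearMap.rotation θ p).1 (ContinuousLinearMap.rotation θ p).2 :=
    ((hf.continuous_fderiv one_ne_zero).comp hR.fst).clm_apply hR.snd
  have h1 := intervalIntegral.integral_eq_sub_of_hasDerivAt (a := 0) (b := Real.pi / 2)
    (fun θ _ => hasDerivAt_comp_rotation hf p θ) (hc.intervalIntegrable _ _)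
  have h2 := sq_intervalIntegral_le hc (by positivity : (0 : ℝ) ≤ Real.pi / 2)
  rw [h1, sub_zero] at h2
  refine le_trans (le_of_eq ?_) h2
  simp only [ContinuousLinearMap.rotation_apply, Real.cos_pi_div_two, Real.sin_pi_div_two,
    Real.cos_zero, Real.sin_zero, zero_smul, one_smul, zero_add, add_zero]
  ring

variable [FiniteDimensional ℝ E] [MeasurableSpace E] [BorelSpace E]

theorem memLp_two_stdGaussian_of_lipschitz {f : E → ℝ} {L : NNReal} (hL : LipschitzWith L f) :
    MemLp f 2 (stdGaussian E) := by
  have h0 : MemLp (fun x : E => ‖x‖) 2 (stdGaussian E) := IsGaussian.memLp_two_id.norm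
  have h1 : MemLp (fun x : E => |f 0| + L * ‖x‖) 2 (stdGaussian E) :=
    (memLp_const |f 0|).add (h0.const_mul (L : ℝ))
  refine h1.mono hL.continuous.aestronglyMeasurable (ae_of_all _ fun x => ?_)
  have h2 := hL.dist_le_mul x 0
  rw [Real.dist_eq, dist_zero_right] at h2
  rw [Real.norm_eq_abs, Real.norm_eq_abs]
  refine le_trans ?_ (le_abs_self _)
  have := abs_sub_abs_le_abs_sub (f x) (f 0)
  linarith

theorem integral_sq_strongDual_stdGaussian (l : StrongDual ℝ E) :
    ∫ y, l y ^ 2 ∂(stdGaussian E) = ‖l‖ ^ 2 := by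
  rw [← variance_dual_stdGaussian l, variance_of_integral_eq_zero (by fun_prop)
    (integral_strongDual_stdGaussian l)]

theorem map_rotation_stdGaussian_prod (θ : ℝ) :
    ((stdGaussian E).prod (stdGaussian E)).map (ContinuousLinearMap.rotation θ) =
      (stdGaussian E).prod (stdGaussian E) :=
  IsGaussian.map_rotation_eq_self_of_forall_strongDual_eq_zero
    (fun l => integral_strongDual_stdGaussian l) θ

/-- A Poincaré inequality, obtained by integrating along rotations of `E × E`. -/
theorem variance_stdGaussian_le_of_lipschitz {f : E → ℝ} (hf : ContDiff ℝ 1 f) {L : NNReal}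
    (hL : LipschitzWith L f) : Var[f; stdGaussian E] ≤ (Real.pi / 2) ^ 2 * L ^ 2 := by
  set γ := stdGaussian E with hγ
  set I := volume.restrict (Set.uIoc (0 : ℝ) (Real.pi / 2)) with hI
  let R : ℝ → E × E → E × E := fun θ p => ContinuousLinearMap.rotation θ p
  let D : E × E → ℝ := fun p => fderiv ℝ f p.1 p.2
  have hDc : Continuous D :=
    ((hf.continuous_fderiv one_ne_zero).comp continuous_fst).clm_apply continuous_snd
  have hD_le : ∀ p, |D p| ≤ L * ‖p.2‖ := fun p =>
    ((fderiv ℝ f p.1).le_opNorm p.2).trans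
      (by gcongr; exact norm_fderiv_le_of_lipschitz ℝ hL)
  have hR : ∀ θ, MeasurePreserving (R θ) (γ.prod γ) (γ.prod γ) := fun θ =>
    ⟨by fun_prop, map_rotation_stdGaussian_prod θ⟩
  have hDint : Integrable (fun p => D p ^ 2) (γ.prod γ) := by
    have h1 : MemLp (fun p : E × E => L * ‖p.2‖) 2 (γ.prod γ) :=
      ((IsGaussian.memLp_two_id (μ := γ)).comp_snd γ).norm.const_mul _
    refine (MemLp.mono h1 hDc.aestronglyMeasurable (ae_of_all _ fun p => ?_)).integrable_sq
    exact (hD_le p).trans (le_abs_self _)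
  have hDval : ∫ p, D p ^ 2 ∂(γ.prod γ) ≤ L ^ 2 := by
    rw [integral_prod _ hDint]
    -- With the first coordinate frozen, `D` is a linear form in an independent standard Gaussian,
    -- so its second moment is the squared norm of the derivative.
    have : ∀ x, ∫ y, D (x, y) ^ 2 ∂γ ≤ L ^ 2 := fun x => by
      rw [show (∫ y, D (x, y) ^ 2 ∂γ) = ‖fderiv ℝ f x‖ ^ 2 from
        integral_sq_strongDual_stdGaussian (fderiv ℝ f x)]
      gcongr
      exact norm_fderiv_le_of_lipschitz ℝ hL
    calc ∫ x, ∫ y, D (x, y) ^ 2 ∂γ ∂γ ≤ ∫ _, (L : ℝ) ^ 2 ∂γ :=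
          integral_mono hDint.integral_prod_left (integrable_const _) this
      _ = L ^ 2 := by simp
  have hpi : (0 : ℝ) ≤ Real.pi / 2 := by positivity
  have hjoint : Continuous fun q : ℝ × (E × E) => D (R q.1 q.2) :=
    hDc.comp continuous_rotation_uncurry
  have hjint : Integrable (fun q : ℝ × (E × E) => D (R q.1 q.2) ^ 2) (I.prod (γ.prod γ)) := by
    have hm : AEStronglyMeasurable (fun q : ℝ × (E × E) => D (R q.1 q.2) ^ 2)
        (I.prod (γ.prod γ)) := (hjoint.pow 2).aestronglyMeasurable
    rw [integrable_prod_iff hm]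
    refine ⟨ae_of_all _ fun θ => (hR θ).integrable_comp_of_integrable hDint, ?_⟩
    have : ∀ θ, ∫ p, ‖D (R θ p) ^ 2‖ ∂(γ.prod γ) = ∫ p, ‖D p ^ 2‖ ∂(γ.prod γ) := fun θ => by
      conv_rhs => rw [← (hR θ).map_eq]
      rw [integral_map (hR θ).aemeasurable]
      exact (hDc.pow 2).norm.aestronglyMeasurable
    simp_rw [this]
    rw [hI, Set.uIoc_of_le hpi]
    exact integrable_const _
  have hpt : ∀ p : E × E, (f p.1 - f p.2) ^ 2 ≤ Real.pi / 2 * ∫ θ, D (R θ p) ^ 2 ∂I := fun p => by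
    rw [hI, Set.uIoc_of_le hpi, ← intervalIntegral.integral_of_le hpi]
    exact sq_sub_le_integral_rotation hf p
  have hfm := memLp_two_stdGaussian_of_lipschitz hL
  have hdiff : MemLp (fun p : E × E => f p.1 - f p.2) 2 (γ.prod γ) :=
    (hfm.comp_fst γ).sub (hfm.comp_snd γ)
  have hvar : Var[fun p : E × E => f p.1 - f p.2; γ.prod γ] = 2 * Var[f; γ] := by
    have := variance_add_prod (X := f) (Y := fun y => - f y) hfm hfm.neg
    simp only [← sub_eq_add_neg] at this
    rw [this, variance_fun_neg]; ring
  have hmain : ∫ p, (f p.1 - f p.2) ^ 2 ∂(γ.prod γ) ≤ (Real.pi / 2) ^ 2 * L ^ 2 := by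
    calc ∫ p, (f p.1 - f p.2) ^ 2 ∂(γ.prod γ)
        ≤ ∫ p, Real.pi / 2 * ∫ θ, D (R θ p) ^ 2 ∂I ∂(γ.prod γ) :=
          integral_mono hdiff.integrable_sq (hjint.integral_prod_right.const_mul _) hpt
      _ = Real.pi / 2 * ∫ θ, ∫ p, D (R θ p) ^ 2 ∂(γ.prod γ) ∂I := by
          rw [integral_const_mul, integral_integral_swap]
          exact hjint.swap
      -- Rotations preserve the product measure, so the inner integral does not depend on the angle.
      _ = Real.pi / 2 * ∫ _, ∫ p, D p ^ 2 ∂(γ.prod γ) ∂I := by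
          congr 2
          ext θ
          conv_rhs => rw [← (hR θ).map_eq]
          rw [integral_map (hR θ).aemeasurable]
          exact (hDc.pow 2).aestronglyMeasurable
      _ = (Real.pi / 2) ^ 2 * ∫ p, D p ^ 2 ∂(γ.prod γ) := by
          rw [integral_const, hI, Set.uIoc_of_le hpi]
          simp [hpi, Measure.real]
          ring
      _ ≤ _ := by gcongr
  -- The estimate bounds twice the variance; the factor two is given up, as only the order of
  -- magnitude matters.
  have h3 := variance_le_expectation_sq (μ := γ.prod γ) hdiff.aestronglyMeasurable
  have h4 := variance_nonneg f γ
  simp only [Pi.pow_apply] at h3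
  linarith

/-- The squared norm is a sum of `n` independent squares. Only linearity in `n` is needed, so `v` is
left unevaluated. -/
theorem exists_variance_norm_sq_stdGaussian : ∃ v : ℝ, 0 ≤ v ∧ ∀ n : ℕ,
    Var[fun z => ‖z‖ ^ 2; stdGaussian (EuclideanSpace ℝ (Fin n))] = n * v := by
  refine ⟨Var[fun t => t ^ 2; gaussianReal 0 1], variance_nonneg _ _, fun n => ?_⟩
  have hm : MemLp (fun t : ℝ => t ^ 2) 2 (gaussianReal 0 1) := by
    exact memLp_two_sq_of_memLp_four (memLp_id_gaussianReal 4)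
  rw [← map_pi_eq_stdGaussian, variance_map (by fun_prop) (by fun_prop)]
  have := variance_sum_pi (μ := fun _ : Fin n => gaussianReal 0 1) (X := fun _ t => t ^ 2)
    fun _ => hm
  simp only [Finset.sum_const, Finset.card_univ, Fintype.card_fin, nsmul_eq_mul] at this
  rw [← this]
  congr 1
  ext z
  simp [EuclideanSpace.norm_sq_eq]

end Poincare

/-! ### The logarithm of a positive combination of exponentials of linear forms -/

section LogSumExp

variable {E ι : Type*} [NormedAddCommGroup E] [InnerProductSpace ℝ E] [Fintype ι] [Nonempty ι]
  {w : ι → ℝ}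

theorem sum_mul_exp_inner_pos (hw : ∀ i, 0 < w i) (a : ι → E) (z : E) :
    0 < ∑ i, w i * Real.exp (inner ℝ z (a i)) :=
  Finset.sum_pos (fun i _ => mul_pos (hw i) (Real.exp_pos _)) Finset.univ_nonempty

theorem contDiff_log_sum_mul_exp_inner (hw : ∀ i, 0 < w i) (a : ι → E) :
    ContDiff ℝ 1 fun z : E => Real.log (∑ i, w i * Real.exp (inner ℝ z (a i))) := by
  refine ContDiff.log ?_ fun z => (sum_mul_exp_inner_pos hw a z).ne'
  exact ContDiff.sum fun i _ => contDiff_const.mul (contDiff_id.inner ℝ contDiff_const).exp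

/-- Moving from `z'` to `z` multiplies each positive summand by at most `exp (L * ‖z - z'‖)`, hence
also the sum. The constant does not depend on the number of summands or on the weights. -/
theorem lipschitzWith_log_sum_mul_exp_inner (hw : ∀ i, 0 < w i) {a : ι → E} {L : NNReal}
    (ha : ∀ i, ‖a i‖ ≤ L) :
    LipschitzWith L fun z : E => Real.log (∑ i, w i * Real.exp (inner ℝ z (a i))) := by
  refine LipschitzWith.of_le_add_mul L fun z z' => ?_
  rw [dist_eq_norm, ← Real.log_exp (L * ‖z - z'‖),
    ← Real.log_mul (sum_mul_exp_inner_pos hw a z').ne' (Real.exp_pos _).ne']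
  refine Real.log_le_log (sum_mul_exp_inner_pos hw a z) ?_
  rw [Finset.sum_mul]
  refine Finset.sum_le_sum fun i _ => ?_
  rw [mul_assoc, ← Real.exp_add]
  refine mul_le_mul_of_nonneg_left (Real.exp_le_exp.2 ?_) (hw i).le
  have h1 : inner ℝ z (a i) = inner ℝ z' (a i) + inner ℝ (z - z') (a i) := by
    rw [inner_sub_left]; ring
  have h2 := real_inner_le_norm (z - z') (a i)
  have h3 : ‖z - z'‖ * ‖a i‖ ≤ L * ‖z - z'‖ := by
    rw [mul_comm]; exact mul_le_mul_of_nonneg_right (ha i) (norm_nonneg _)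
  linarith

end LogSumExp

/-! ### Densities of Gaussian mixtures -/

section Density

/-- The density of the standard Gaussian distribution. -/
noncomputable def stdGaussianDensity {E : Type*} [NormedAddCommGroup E] [InnerProductSpace ℝ E]
    (v : E) : ℝ :=
  (2 * Real.pi) ^ (-(Module.finrank ℝ E / 2 : ℝ)) * Real.exp (-(1 / 2) * ‖v‖ ^ 2)

variable {E : Type*} [NormedAddCommGroup E] [InnerProductSpace ℝ E]

theorem stdGaussianDensity_pos (v : E) : 0 < stdGaussianDensity v := by
  unfold stdGaussianDensity; positivity

theorem continuous_stdGaussianDensity : Continuous (stdGaussianDensity : E → ℝ) := by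
  unfold stdGaussianDensity; fun_prop

variable [FiniteDimensional ℝ E] [MeasurableSpace E] [BorelSpace E]

theorem integrable_stdGaussianDensity : Integrable (stdGaussianDensity : E → ℝ) := by
  unfold stdGaussianDensity
  refine Integrable.const_mul ?_ _
  refine Integrable.of_integral_ne_zero ?_
  rw [GaussianFourier.integral_rexp_neg_mul_sq_norm (by norm_num)]
  positivity

/-- Both sides are finite measures with the same characteristic function, by the Gaussian Fourier
integral. -/
theorem stdGaussian_eq_withDensity :
    stdGaussian E = volume.withDensity fun v => ENNReal.ofReal (stdGaussianDensity v) := by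
  have : IsFiniteMeasure (volume.withDensity fun v : E => ENNReal.ofReal (stdGaussianDensity v)) :=
    isFiniteMeasure_withDensity_ofReal integrable_stdGaussianDensity.2
  refine Measure.ext_of_charFun (funext fun t => ?_)
  rw [charFun_stdGaussian, charFun_apply, integral_withDensity_eq_integral_toReal_smul
    (by exact continuous_stdGaussianDensity.measurable.ennreal_ofReal) (by simp)]
  have h := GaussianFourier.integral_cexp_neg_mul_sq_norm_add (V := E) (b := 1 / 2) (by norm_num)
    Complex.I t
  have h2 : ∀ v : E, (ENNReal.ofReal (stdGaussianDensity v)).toReal •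
      Complex.exp (inner ℝ v t * Complex.I) =
      ((2 * Real.pi) ^ (-(Module.finrank ℝ E / 2 : ℝ)) : ℝ) *
        Complex.exp (-(1 / 2) * ‖v‖ ^ 2 + Complex.I * inner ℝ t v) := fun v => by
    rw [ENNReal.toReal_ofReal (stdGaussianDensity_pos v).le, stdGaussianDensity, Complex.real_smul,
      Complex.exp_add, real_inner_comm]
    push_cast
    ring_nf
  simp_rw [h2]
  rw [integral_const_mul, h]
  have h3 : (Real.pi / (1 / 2 : ℂ)) ^ (Module.finrank ℝ E / 2 : ℂ) =
      (((2 * Real.pi) ^ (Module.finrank ℝ E / 2 : ℝ) : ℝ) : ℂ) := by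
    rw [Complex.ofReal_cpow (by positivity)]
    push_cast
    congr 1
    ring
  rw [h3, ← mul_assoc, ← Complex.ofReal_mul, ← Real.rpow_add (by positivity)]
  simp only [neg_add_cancel, Real.rpow_zero, Complex.ofReal_one, one_mul, Complex.I_sq]
  congr 1
  ring

end Density

section Mixture

variable {n M : ℕ}

theorem multivariateGaussian_one_eq_map (x : EuclideanSpace ℝ (Fin n)) :
    multivariateGaussian x (1 : Matrix (Fin n) (Fin n) ℝ) =
      (stdGaussian (EuclideanSpace ℝ (Fin n))).map (fun z => x + z) := by
  simp [multivariateGaussian]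

theorem multivariateGaussian_one_eq_withDensity (x : EuclideanSpace ℝ (Fin n)) :
    multivariateGaussian x (1 : Matrix (Fin n) (Fin n) ℝ) =
      volume.withDensity fun y => ENNReal.ofReal (stdGaussianDensity (y - x)) := by
  rw [multivariateGaussian_one_eq_map, stdGaussian_eq_withDensity]
  ext s hs
  have hmp := measurePreserving_add_left (volume : Measure (EuclideanSpace ℝ (Fin n))) x
  rw [Measure.map_apply (by fun_prop) hs, withDensity_apply _ (hs.preimage (by fun_prop)),
    withDensity_apply _ hs, ← hmp.setLIntegral_comp_preimage hs]
  · simp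
  · exact (continuous_stdGaussianDensity.comp (by fun_prop)).measurable.ennreal_ofReal

/-- The uniform mixture of the normal distributions with identity covariance and means `x i`. -/
noncomputable def gaussianMixture (x : Fin M → EuclideanSpace ℝ (Fin n)) :
    Measure (EuclideanSpace ℝ (Fin n)) :=
  (M : ENNReal)⁻¹ • ∑ i, multivariateGaussian (x i) (1 : Matrix (Fin n) (Fin n) ℝ)

/-- The density of `gaussianMixture x`. -/
noncomputable def gaussianMixtureDensity (x : Fin M → EuclideanSpace ℝ (Fin n))
    (y : EuclideanSpace ℝ (Fin n)) : ℝ :=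
  (M : ℝ)⁻¹ * ∑ i, stdGaussianDensity (y - x i)

/-- The log-likelihood ratio of `gaussianMixture x` and its `j`-th component, as a function of the
noise. -/
noncomputable def mixtureLLR (x : Fin M → EuclideanSpace ℝ (Fin n)) (j : Fin M)
    (z : EuclideanSpace ℝ (Fin n)) : ℝ :=
  Real.log (∑ i, ((M : ℝ)⁻¹ * Real.exp (-(1 / 2) * ‖x i - x j‖ ^ 2)) *
    Real.exp (inner ℝ z (x i - x j)))

variable (x : Fin M → EuclideanSpace ℝ (Fin n))

theorem continuous_gaussianMixtureDensity : Continuous (gaussianMixtureDensity x) := by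
  unfold gaussianMixtureDensity
  exact continuous_const.mul (continuous_finsetSum _ fun i _ =>
    continuous_stdGaussianDensity.comp (by fun_prop))

theorem gaussianMixtureDensity_nonneg (y : EuclideanSpace ℝ (Fin n)) :
    0 ≤ gaussianMixtureDensity x y :=
  mul_nonneg (by positivity) (Finset.sum_nonneg fun _ _ => (stdGaussianDensity_pos _).le)

theorem gaussianMixture_eq_withDensity (hM : 0 < M) :
    gaussianMixture x = volume.withDensity fun y => ENNReal.ofReal (gaussianMixtureDensity x y) := by
  have hm : ∀ i, Measurable fun y => ENNReal.ofReal (stdGaussianDensity (y - x i)) := fun i =>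
    (continuous_stdGaussianDensity.comp (by fun_prop)).measurable.ennreal_ofReal
  have h : (fun y => ENNReal.ofReal (gaussianMixtureDensity x y)) =
      (M : ENNReal)⁻¹ • ∑ i, fun y => ENNReal.ofReal (stdGaussianDensity (y - x i)) := by
    ext y
    rw [gaussianMixtureDensity, ENNReal.ofReal_mul (by positivity),
      ENNReal.ofReal_sum_of_nonneg fun _ _ => (stdGaussianDensity_pos _).le,
      ENNReal.ofReal_inv_of_pos (by positivity), ENNReal.ofReal_natCast]
    simp
  ext s hs
  have hs' : Measurable (∑ i, fun y => ENNReal.ofReal (stdGaussianDensity (y - x i))) :=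
    Finset.sum_induction _ Measurable (fun _ _ hf hg => hf.add hg) measurable_zero fun i _ => hm i
  rw [h, gaussianMixture, withDensity_smul _ hs']
  simp only [Measure.smul_apply, Measure.finsetSum_apply, multivariateGaussian_one_eq_withDensity]
  congr 1
  simp only [withDensity_apply _ hs, Finset.sum_apply]
  rw [lintegral_finsetSum _ fun i _ => hm i]

theorem isProbabilityMeasure_gaussianMixture (hM : 0 < M) :
    IsProbabilityMeasure (gaussianMixture x) := by
  refine ⟨?_⟩
  simp only [gaussianMixture, Measure.smul_apply, Measure.finsetSum_apply, measure_univ]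
  simp [ENNReal.inv_mul_cancel, hM.ne']

theorem lebesgueDensity_gaussianMixture (hM : 0 < M) :
    lebesgueDensity (gaussianMixture x) =ᵐ[gaussianMixture x] gaussianMixtureDensity x := by
  have hm : Measurable fun y => ENNReal.ofReal (gaussianMixtureDensity x y) :=
    (continuous_gaussianMixtureDensity x).measurable.ennreal_ofReal
  have h := gaussianMixture_eq_withDensity x hM
  have hac : gaussianMixture x ≪ volume := h ▸ withDensity_absolutelyContinuous _ _
  refine hac.ae_le ?_
  filter_upwards [Measure.rnDeriv_withDensity volume hm] with y hy
  rw [lebesgueDensity, h, hy, ENNReal.toReal_ofReal (gaussianMixtureDensity_nonneg x y)]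

/-- Expanding `‖z - (x i - x j)‖ ^ 2` lets the factor `exp (-‖z‖ ^ 2 / 2)` come out of every
summand; the cross term is the linear form in the log-sum-exp. -/
theorem gaussianMixtureDensity_eq_mul_exp (hM : 0 < M) (j : Fin M) (z : EuclideanSpace ℝ (Fin n)) :
    gaussianMixtureDensity x (x j + z) = stdGaussianDensity z * Real.exp (mixtureLLR x j z) := by
  have : Nonempty (Fin M) := ⟨j⟩
  rw [mixtureLLR, Real.exp_log (sum_mul_exp_inner_pos (fun i => by positivity) _ z),
    gaussianMixtureDensity, Finset.mul_sum, Finset.mul_sum]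
  refine Finset.sum_congr rfl fun i _ => ?_
  rw [stdGaussianDensity, stdGaussianDensity, show x j + z - x i = z - (x i - x j) by abel,
    norm_sub_sq_real]
  rw [show ∀ a b c d e : ℝ, a * b * (c * d * e) = c * (a * (b * d * e)) by intros; ring,
    ← Real.exp_add, ← Real.exp_add]
  ring_nf

theorem log_gaussianMixtureDensity (hM : 0 < M) (j : Fin M) (z : EuclideanSpace ℝ (Fin n)) :
    Real.log (gaussianMixtureDensity x (x j + z)) =
      mixtureLLR x j z + Real.log ((2 * Real.pi) ^ (-(n / 2 : ℝ))) - ‖z‖ ^ 2 / 2 := by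
  rw [gaussianMixtureDensity_eq_mul_exp x hM, Real.log_mul (stdGaussianDensity_pos z).ne' (Real.exp_pos _).ne',
    Real.log_exp, stdGaussianDensity, Real.log_mul (by positivity) (Real.exp_pos _).ne',
    Real.log_exp, finrank_euclideanSpace_fin]
  ring

/-- The summand `i = j` alone equals `1 / M`. -/
theorem neg_log_le_mixtureLLR (hM : 0 < M) (j : Fin M) (z : EuclideanSpace ℝ (Fin n)) :
    -Real.log M ≤ mixtureLLR x j z := by
  rw [← Real.log_inv, mixtureLLR]
  refine Real.log_le_log (by positivity) ?_
  refine le_trans ?_ (Finset.single_le_sum (fun i _ => by positivity) (Finset.mem_univ j))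
  simp

theorem contDiff_mixtureLLR (hM : 0 < M) (j : Fin M) : ContDiff ℝ 1 (mixtureLLR x j) := by
  have : Nonempty (Fin M) := ⟨j⟩
  exact contDiff_log_sum_mul_exp_inner (fun i => by positivity) _

theorem lipschitzWith_mixtureLLR (hM : 0 < M) (j : Fin M) {L : NNReal}
    (hL : ∀ i, ‖x i - x j‖ ≤ L) : LipschitzWith L (mixtureLLR x j) := by
  have : Nonempty (Fin M) := ⟨j⟩
  exact lipschitzWith_log_sum_mul_exp_inner (fun i => by positivity) hL

theorem integrable_gaussianMixture {h : EuclideanSpace ℝ (Fin n) → ℝ} (hM : 0 < M)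
    (hm : Measurable h)
    (hh : ∀ j, Integrable (fun z => h (x j + z)) (stdGaussian (EuclideanSpace ℝ (Fin n)))) :
    Integrable h (gaussianMixture x) := by
  refine Integrable.smul_measure ?_ (by simp [hM.ne'])
  refine integrable_finsetSum_measure.2 fun i _ => ?_
  rw [multivariateGaussian_one_eq_map]
  exact (integrable_map_measure hm.aestronglyMeasurable (by fun_prop)).2 (hh i)

theorem integral_gaussianMixture {h : EuclideanSpace ℝ (Fin n) → ℝ}
    (hm : Measurable h)
    (hh : ∀ j, Integrable (fun z => h (x j + z)) (stdGaussian (EuclideanSpace ℝ (Fin n)))) :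
    ∫ y, h y ∂(gaussianMixture x) =
      (M : ℝ)⁻¹ * ∑ j, ∫ z, h (x j + z) ∂(stdGaussian (EuclideanSpace ℝ (Fin n))) := by
  rw [gaussianMixture, integral_smul_measure, integral_finsetSum_measure]
  · simp only [multivariateGaussian_one_eq_map, smul_eq_mul, ENNReal.toReal_inv,
      ENNReal.toReal_natCast]
    congr 1
    refine Finset.sum_congr rfl fun i _ => integral_map (by fun_prop) hm.aestronglyMeasurable
  · intro i _
    rw [multivariateGaussian_one_eq_map]
    exact (integrable_map_measure hm.aestronglyMeasurable (by fun_prop)).2 (hh i)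

/-- Change of measure from `gaussianMixture x` to its `j`-th component. -/
theorem integral_gaussianMixture_eq_integral_exp (hM : 0 < M) (j : Fin M)
    (h : EuclideanSpace ℝ (Fin n) → ℝ) :
    ∫ y, h y ∂(gaussianMixture x) = ∫ z, h (x j + z) * Real.exp (mixtureLLR x j z)
      ∂(stdGaussian (EuclideanSpace ℝ (Fin n))) := by
  rw [gaussianMixture_eq_withDensity x hM, stdGaussian_eq_withDensity,
    integral_withDensity_eq_integral_toReal_smul
      (continuous_gaussianMixtureDensity x).measurable.ennreal_ofReal (by simp),
    integral_withDensity_eq_integral_toReal_smul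
      (by exact continuous_stdGaussianDensity.measurable.ennreal_ofReal) (by simp),
    ← integral_add_left_eq_self _ (x j)]
  refine integral_congr_ae (ae_of_all _ fun z => ?_)
  simp only [smul_eq_mul]
  rw [ENNReal.toReal_ofReal (gaussianMixtureDensity_nonneg x _),
    ENNReal.toReal_ofReal (stdGaussianDensity_pos z).le, gaussianMixtureDensity_eq_mul_exp x hM]
  ring

theorem integrable_exp_mixtureLLR (hM : 0 < M) (j : Fin M) :
    Integrable (fun z => Real.exp (mixtureLLR x j z))
      (stdGaussian (EuclideanSpace ℝ (Fin n))) := by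
  refine Integrable.of_integral_ne_zero ?_
  have h := integral_gaussianMixture_eq_integral_exp x hM j fun _ => 1
  have := isProbabilityMeasure_gaussianMixture x hM
  simp only [one_mul, integral_const, probReal_univ, smul_eq_mul] at h
  rw [← h]
  exact one_ne_zero

end Mixture

/-! ### The strong converse and the variance of the log-density -/

/-- Beyond `A`, combine `t ^ 2 ≤ 2 * A ^ 2 + 2 * (t - A) ^ 2` with `s ^ 2 ≤ 2 * exp s` for `s = t -
A ≥ 0`. -/
theorem sq_le_two_mul_sq_add_exp {t A : ℝ} (ht : 0 ≤ t) :
    t ^ 2 ≤ 2 * A ^ 2 + 4 * Real.exp (t - A) := by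
  rcases le_total t A with h | h
  · nlinarith [Real.exp_pos (t - A)]
  · nlinarith [Real.quadratic_le_exp_of_nonneg (sub_nonneg.2 h), sq_nonneg (t - 2 * A)]

/-- Turns the exponential moment supplied by the decoder into a second moment. The bound is
quadratic in `A`, so `A = O(√n)` yields a linear bound. -/
theorem mean_sq_le_of_mean_exp_le {M : ℕ} (hM : 0 < M) {T : Fin M → ℝ} (hT : ∀ j, 0 ≤ T j)
    {A : ℝ} (h : (M : ℝ)⁻¹ * ∑ j, Real.exp (T j) ≤ Real.exp A) :
    (M : ℝ)⁻¹ * ∑ j, T j ^ 2 ≤ 2 * A ^ 2 + 4 := by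
  have hM' : (0 : ℝ) < M := by exact_mod_cast hM
  calc (M : ℝ)⁻¹ * ∑ j, T j ^ 2
      ≤ (M : ℝ)⁻¹ * ∑ j, (2 * A ^ 2 + 4 * (Real.exp (T j) * Real.exp (-A))) := by
        gcongr with j
        rw [← Real.exp_add, ← sub_eq_add_neg]
        exact sq_le_two_mul_sq_add_exp (hT j)
    _ = 2 * A ^ 2 + 4 * (Real.exp (-A) * ((M : ℝ)⁻¹ * ∑ j, Real.exp (T j))) := by
        rw [Finset.sum_add_distrib, ← Finset.mul_sum Finset.univ _ (4 : ℝ),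
          ← Finset.sum_mul Finset.univ (fun j => Real.exp (T j))]
        simp
        field_simp
    _ ≤ 2 * A ^ 2 + 4 * (Real.exp (-A) * Real.exp A) := by gcongr
    _ = 2 * A ^ 2 + 4 := by rw [← Real.exp_add]; simp

section

variable {Ω : Type*} [MeasurableSpace Ω] {μ : Measure Ω} [IsProbabilityMeasure μ]

theorem sq_integral_abs_sub_le_variance {f : Ω → ℝ} (hf : MemLp f 2 μ) :
    (∫ ω, |f ω - ∫ ω', f ω' ∂μ| ∂μ) ^ 2 ≤ Var[f; μ] := by
  have h1 : MemLp (fun ω => |f ω - ∫ ω', f ω' ∂μ|) 2 μ := (hf.sub (memLp_const _)).abs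
  have h2 := variance_nonneg (fun ω => |f ω - ∫ ω', f ω' ∂μ|) μ
  rw [variance_eq_sub h1] at h2
  simp only [Pi.pow_apply, sq_abs] at h2
  rw [variance_eq_integral hf.aemeasurable]
  linarith

/-- A lower bound on the probability under the measure with density `exp f` of a randomized test,
in terms of its probability under `μ`. -/
theorem mul_exp_le_integral_mul_exp {f G : Ω → ℝ} (hf : MemLp f 2 μ)
    (hfe : Integrable (fun ω => Real.exp (f ω)) μ) (hG : Measurable G) (hG0 : ∀ ω, 0 ≤ G ω)
    (hG1 : ∀ ω, G ω ≤ 1) {δ σ : ℝ} (hδ : 0 < δ) (hσ0 : 0 ≤ σ) (hδG : δ ≤ ∫ ω, G ω ∂μ)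
    (hσ : Var[f; μ] ≤ σ ^ 2) :
    δ * Real.exp ((∫ ω, f ω ∂μ) - σ / δ) ≤ ∫ ω, G ω * Real.exp (f ω) ∂μ := by
  set m := ∫ ω, f ω ∂μ with hm
  have hdev : ∫ ω, |f ω - m| ∂μ ≤ σ :=
    abs_le_of_sq_le_sq' ((sq_integral_abs_sub_le_variance hf).trans hσ) hσ0 |>.2
  have hGn : ∀ ω, ‖G ω‖ ≤ 1 := fun ω => by rw [Real.norm_of_nonneg (hG0 ω)]; exact hG1 ω
  have hGi : Integrable G μ := Integrable.of_bound hG.aestronglyMeasurable 1 (ae_of_all _ hGn)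
  have hfi : Integrable (fun ω => |f ω - m|) μ :=
    ((hf.integrable one_le_two).sub (integrable_const _)).abs
  have hprod : Integrable (fun ω => G ω * Real.exp (f ω)) μ :=
    hfe.bdd_mul hG.aestronglyMeasurable (ae_of_all _ hGn)
  -- The exponential is bounded below by its tangent at `m - σ / δ`; this point is chosen so that
  -- `(1 + σ / δ) * δ - σ = δ`.
  calc δ * Real.exp (m - σ / δ) = Real.exp (m - σ / δ) * ((1 + σ / δ) * δ - σ) := by
        field_simp; ring
    _ ≤ Real.exp (m - σ / δ) * ((1 + σ / δ) * (∫ ω, G ω ∂μ) - ∫ ω, |f ω - m| ∂μ) := by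
        gcongr
    _ = ∫ ω, Real.exp (m - σ / δ) * ((1 + σ / δ) * G ω - |f ω - m|) ∂μ := by
        rw [integral_const_mul, integral_sub (hGi.const_mul _) hfi, integral_const_mul]
    _ ≤ ∫ ω, G ω * Real.exp (f ω) ∂μ := by
        refine integral_mono (((hGi.const_mul _).sub hfi).const_mul _) hprod fun ω => ?_
        have h1 := Real.add_one_le_exp (f ω - m + σ / δ)
        have h2 : Real.exp (f ω) = Real.exp (m - σ / δ) * Real.exp (f ω - m + σ / δ) := by
          rw [← Real.exp_add]; congr 1; ring
        simp only [h2]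
        rw [mul_left_comm]
        refine mul_le_mul_of_nonneg_left ?_ (Real.exp_pos _).le
        have h3 : G ω * (f ω - m + σ / δ + 1) ≤ G ω * Real.exp (f ω - m + σ / δ) :=
          mul_le_mul_of_nonneg_left h1 (hG0 ω)
        -- The test takes values in `[0, 1]`, so weighting the deviation by it costs at most the
        -- absolute deviation.
        have h4 : -|f ω - m| ≤ G ω * (f ω - m) := by
          have h5 : |G ω * (f ω - m)| ≤ |f ω - m| := by
            rw [abs_mul, abs_of_nonneg (hG0 ω)]
            exact mul_le_of_le_one_left (abs_nonneg _) (hG1 ω)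
          linarith [neg_abs_le (G ω * (f ω - m))]
        linarith

end

theorem Kernel.sum_integral_real_singleton {Y : Type*} [MeasurableSpace Y] {M : ℕ}
    (g : Kernel Y (Fin M)) [IsMarkovKernel g] (μ : Measure Y) [IsProbabilityMeasure μ] :
    ∑ j, ∫ y, (g y).real {j} ∂μ = 1 := by
  rw [← integral_finsetSum]
  · simp
  · intro j _
    exact Integrable.of_bound
      (g.measurable_coe (measurableSet_singleton j)).ennreal_toReal.aestronglyMeasurable
      1 (ae_of_all _ fun y => by
        rw [Real.norm_of_nonneg measureReal_nonneg]; exact measureReal_le_one)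

section

variable {n M : ℕ} {x : Fin M → EuclideanSpace ℝ (Fin n)}

theorem memLp_mixtureLLR (hM : 0 < M) {L : NNReal} (hL : ∀ i j, ‖x i - x j‖ ≤ L) (j : Fin M) :
    MemLp (mixtureLLR x j) 2 (stdGaussian (EuclideanSpace ℝ (Fin n))) :=
  memLp_two_stdGaussian_of_lipschitz (lipschitzWith_mixtureLLR x hM j fun i => hL i j)

theorem variance_mixtureLLR_le (hM : 0 < M) {L : NNReal} (hL : ∀ i j, ‖x i - x j‖ ≤ L)
    (j : Fin M) :
    Var[mixtureLLR x j; stdGaussian (EuclideanSpace ℝ (Fin n))] ≤ (Real.pi / 2 * L) ^ 2 := by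
  rw [mul_pow]
  exact variance_stdGaussian_le_of_lipschitz (contDiff_mixtureLLR x hM j)
    (lipschitzWith_mixtureLLR x hM j fun i => hL i j)

/-- A strong converse averaged over messages: under the mixture, the acceptance probabilities of the
`M` messages sum to one, while each is bounded below exponentially in its own mean log-likelihood
ratio. -/
theorem mean_sq_log_add_integral_mixtureLLR_le (hM : 0 < M) {L : NNReal}
    (hL : ∀ i j, ‖x i - x j‖ ≤ L) (g : Kernel (EuclideanSpace ℝ (Fin n)) (Fin M))
    [IsMarkovKernel g] {δ : ℝ} (hδ : 0 < δ)
    (hg : ∀ j, δ ≤ ∫ z, (g (x j + z)).real {j} ∂(stdGaussian (EuclideanSpace ℝ (Fin n)))) :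
    (M : ℝ)⁻¹ * ∑ j, (Real.log M +
        ∫ z, mixtureLLR x j z ∂(stdGaussian (EuclideanSpace ℝ (Fin n)))) ^ 2
      ≤ 2 * (Real.pi / 2 * L / δ - Real.log δ) ^ 2 + 4 := by
  set γ := stdGaussian (EuclideanSpace ℝ (Fin n)) with hγ
  have hM' : (0 : ℝ) < M := by exact_mod_cast hM
  have := isProbabilityMeasure_gaussianMixture x hM
  refine mean_sq_le_of_mean_exp_le hM (fun j => ?_) ?_
  · have h1 : ∫ _, -Real.log M ∂γ ≤ ∫ z, mixtureLLR x j z ∂γ :=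
      integral_mono (integrable_const _) ((memLp_mixtureLLR hM hL j).integrable one_le_two)
        (neg_log_le_mixtureLLR x hM j)
    simp only [integral_const, probReal_univ, one_smul] at h1
    linarith
  · have h1 : ∀ j, δ * Real.exp ((∫ z, mixtureLLR x j z ∂γ) - Real.pi / 2 * L / δ) ≤
        ∫ y, (g y).real {j} ∂(gaussianMixture x) := fun j => by
      rw [integral_gaussianMixture_eq_integral_exp x hM j]
      refine mul_exp_le_integral_mul_exp (memLp_mixtureLLR hM hL j)
        (integrable_exp_mixtureLLR x hM j) ?_ (fun _ => measureReal_nonneg)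
        (fun _ => measureReal_le_one) hδ (by positivity) (hg j) (variance_mixtureLLR_le hM hL j)
      exact ((g.measurable_coe (measurableSet_singleton j)).comp
        (measurable_const_add (x j))).ennreal_toReal
    have h2 := Finset.sum_le_sum fun j (_ : j ∈ Finset.univ) => h1 j
    rw [Kernel.sum_integral_real_singleton] at h2
    have h3 : ∀ j, Real.exp (Real.log M + ∫ z, mixtureLLR x j z ∂γ) =
        M * Real.exp (Real.pi / 2 * L / δ - Real.log δ) *
          (δ * Real.exp ((∫ z, mixtureLLR x j z ∂γ) - Real.pi / 2 * L / δ)) := fun j => by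
      have : Real.exp (Real.pi / 2 * L / δ - Real.log δ) *
          (δ * Real.exp ((∫ z, mixtureLLR x j z ∂γ) - Real.pi / 2 * L / δ)) =
          Real.exp (∫ z, mixtureLLR x j z ∂γ) := by
        rw [Real.exp_sub, Real.exp_sub, Real.exp_log hδ]
        field_simp
      rw [Real.exp_add, Real.exp_log hM', mul_assoc, this]
    simp_rw [h3]
    rw [← Finset.mul_sum, mul_assoc, inv_mul_cancel_left₀ hM'.ne']
    exact mul_le_of_le_one_right (Real.exp_pos _).le h2

theorem memLp_norm_sq_stdGaussian :
    MemLp (fun z => ‖z‖ ^ 2) 2 (stdGaussian (EuclideanSpace ℝ (Fin n))) := by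
  exact memLp_two_sq_of_memLp_four
    (IsGaussian.memLp_id (stdGaussian (EuclideanSpace ℝ (Fin n))) 4 (by simp)).norm

theorem variance_log_gaussianMixtureDensity_le (hM : 0 < M) {L : NNReal}
    (hL : ∀ i j, ‖x i - x j‖ ≤ L) (g : Kernel (EuclideanSpace ℝ (Fin n)) (Fin M))
    [IsMarkovKernel g] {δ : ℝ} (hδ : 0 < δ)
    (hg : ∀ j, δ ≤ ∫ z, (g (x j + z)).real {j} ∂(stdGaussian (EuclideanSpace ℝ (Fin n)))) :
    MemLp (fun y => Real.log (gaussianMixtureDensity x y)) 2 (gaussianMixture x) ∧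
    Var[fun y => Real.log (gaussianMixtureDensity x y); gaussianMixture x] ≤
      3 * ((Real.pi / 2 * L) ^ 2 + (2 * (Real.pi / 2 * L / δ - Real.log δ) ^ 2 + 4) +
        Var[fun z => ‖z‖ ^ 2; stdGaussian (EuclideanSpace ℝ (Fin n))] / 4) := by
  set γ := stdGaussian (EuclideanSpace ℝ (Fin n)) with hγ
  have hM' : (0 : ℝ) < M := by exact_mod_cast hM
  have := isProbabilityMeasure_gaussianMixture x hM
  set m := ∫ z, ‖z‖ ^ 2 ∂γ with hm
  set κ := Real.log ((2 * Real.pi) ^ (-(n / 2 : ℝ))) with hκ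
  -- Any common centre bounds the variance. This one does not depend on `j` and leaves, on the
  -- `j`-th component, the two centred fluctuations and the offset `T j`.
  set c := κ - m / 2 - Real.log M with hc
  let F : Fin M → ℝ := fun j => ∫ z, mixtureLLR x j z ∂γ
  let T : Fin M → ℝ := fun j => Real.log M + F j
  have hmeas : Measurable fun y => Real.log (gaussianMixtureDensity x y) :=
    (continuous_gaussianMixtureDensity x).measurable.log
  have hf := memLp_mixtureLLR hM hL
  have hN : MemLp (fun z => ‖z‖ ^ 2) 2 γ := memLp_norm_sq_stdGaussian
  have hlog : ∀ j z, Real.log (gaussianMixtureDensity x (x j + z)) - c =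
      (mixtureLLR x j z - F j) + T j - (‖z‖ ^ 2 - m) / 2 := fun j z => by
    rw [log_gaussianMixtureDensity x hM, hc]
    simp only [T]
    ring
  have hA : ∀ j, MemLp (fun z => mixtureLLR x j z - F j) 2 γ := fun j => (hf j).sub (memLp_const _)
  have hB : MemLp (fun z => ‖z‖ ^ 2 - m) 2 γ := hN.sub (memLp_const _)
  have hlogL : ∀ j, MemLp (fun z => Real.log (gaussianMixtureDensity x (x j + z)) - c) 2 γ :=
    fun j => by
      simp_rw [hlog, div_eq_inv_mul]
      exact ((hA j).add (memLp_const (T j))).sub (hB.const_mul 2⁻¹)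
  have hint : Integrable (fun y => (Real.log (gaussianMixtureDensity x y) - c) ^ 2)
      (gaussianMixture x) :=
    integrable_gaussianMixture x hM ((hmeas.sub_const c).pow_const 2) fun j =>
      (hlogL j).integrable_sq
  have hmem : MemLp (fun y => Real.log (gaussianMixtureDensity x y) - c) 2 (gaussianMixture x) :=
    (memLp_two_iff_integrable_sq (hmeas.sub_const c).aestronglyMeasurable).2 hint
  have hmem' : MemLp (fun y => Real.log (gaussianMixtureDensity x y)) 2 (gaussianMixture x) := by
    convert hmem.add (memLp_const c) using 1
    ext y
    simp
  refine ⟨hmem', ?_⟩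
  rw [← variance_sub_const hmem'.aestronglyMeasurable c]
  refine (variance_le_expectation_sq hmem.aestronglyMeasurable).trans ?_
  simp only [Pi.pow_apply]
  rw [integral_gaussianMixture x ((hmeas.sub_const c).pow_const 2) fun j =>
    (hlogL j).integrable_sq]
  have hj : ∀ j, ∫ z, (Real.log (gaussianMixtureDensity x (x j + z)) - c) ^ 2 ∂γ ≤
      3 * ((Real.pi / 2 * L) ^ 2 + T j ^ 2 + Var[fun z => ‖z‖ ^ 2; γ] / 4) := fun j => by
    calc ∫ z, (Real.log (gaussianMixtureDensity x (x j + z)) - c) ^ 2 ∂γ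
        ≤ ∫ z, 3 * ((mixtureLLR x j z - F j) ^ 2 + T j ^ 2 + (‖z‖ ^ 2 - m) ^ 2 / 4) ∂γ := by
          refine integral_mono (hlogL j).integrable_sq ((((hA j).integrable_sq.add
            (integrable_const _)).add (hB.integrable_sq.div_const 4)).const_mul 3) fun z => ?_
          simp only [hlog]
          -- This is `(a + b - d) ^ 2 ≤ 3 * (a ^ 2 + b ^ 2 + d ^ 2)`; the gap is the sum of the
          -- three squares supplied.
          nlinarith [sq_nonneg (mixtureLLR x j z - F j - T j),
            sq_nonneg (mixtureLLR x j z - F j + (‖z‖ ^ 2 - m) / 2),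
            sq_nonneg (T j + (‖z‖ ^ 2 - m) / 2)]
      _ = 3 * (Var[mixtureLLR x j; γ] + T j ^ 2 + Var[fun z => ‖z‖ ^ 2; γ] / 4) := by
          rw [variance_eq_integral (hf j).aemeasurable, variance_eq_integral hN.aemeasurable,
            integral_const_mul, integral_add (by exact (hA j).integrable_sq.add (integrable_const _))
              (by exact hB.integrable_sq.div_const 4),
            integral_add (hA j).integrable_sq (integrable_const _), integral_div]
          simp [F, m, hγ]
      _ ≤ _ := by
          gcongr
          exact variance_mixtureLLR_le hM hL j
  calc (M : ℝ)⁻¹ * ∑ j, ∫ z, (Real.log (gaussianMixtureDensity x (x j + z)) - c) ^ 2 ∂γ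
      ≤ (M : ℝ)⁻¹ * ∑ j, 3 * ((Real.pi / 2 * L) ^ 2 + T j ^ 2 +
          Var[fun z => ‖z‖ ^ 2; γ] / 4) := by
        gcongr with j
        exact hj j
    _ = 3 * ((Real.pi / 2 * L) ^ 2 + (M : ℝ)⁻¹ * ∑ j, T j ^ 2 +
          Var[fun z => ‖z‖ ^ 2; γ] / 4) := by
        rw [← Finset.mul_sum, Finset.sum_add_distrib, Finset.sum_add_distrib]
        simp
        field_simp
    _ ≤ _ := by
        gcongr
        exact mean_sq_log_add_integral_mixtureLLR_le hM hL g hδ hg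

end

/-! ### Codes for the Gaussian channel -/

namespace MaxDetCode

variable {P ε : ℝ} {n M : ℕ} (c : MaxDetCode (awgn P n) M ε)

theorem outputDist_eq_gaussianMixture :
    c.outputDist = gaussianMixture fun j => (c.encoder j : EuclideanSpace ℝ (Fin n)) := by
  ext s hs
  rw [outputDist, inputDist, Measure.bind_apply hs (Kernel.aemeasurable _),
    lintegral_map ((awgn P n).measurable_coe hs) (measurable_of_finite _), uniformOn,
    ProbabilityTheory.cond]
  simp [lintegral_smul_measure, gaussianMixture, lintegral_count, tsum_fintype, awgn]

theorem one_sub_le_integral_decoder (j : Fin M) :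
    1 - ε ≤ ∫ z, (c.decoder (c.encoder j + z)).real {j}
      ∂(stdGaussian (EuclideanSpace ℝ (Fin n))) := by
  have := c.isMarkovKernel_decoder
  have hm : Measurable fun y => c.decoder y {j} :=
    c.decoder.measurable_coe (measurableSet_singleton j)
  have h1 : awgn P n (c.encoder j) = (stdGaussian (EuclideanSpace ℝ (Fin n))).map
      (fun z => (c.encoder j : EuclideanSpace ℝ (Fin n)) + z) :=
    multivariateGaussian_one_eq_map _
  have : IsProbabilityMeasure (awgn P n (c.encoder j)) := by
    rw [h1]; exact Measure.isProbabilityMeasure_map (by fun_prop)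
  have : IsProbabilityMeasure ((c.decoder ∘ₖ awgn P n) (c.encoder j)) := by
    rw [Kernel.comp_apply]; infer_instance
  have h2 := c.error_le j
  rw [probReal_compl_eq_one_sub (measurableSet_singleton j)] at h2
  have h3 : ((c.decoder ∘ₖ awgn P n) (c.encoder j)).real {j} =
      ∫ z, (c.decoder (c.encoder j + z)).real {j}
        ∂(stdGaussian (EuclideanSpace ℝ (Fin n))) := by
    rw [measureReal_def, Kernel.comp_apply' _ _ _ (measurableSet_singleton j), h1,
      lintegral_map hm (by fun_prop)]
    simp only [measureReal_def]
    exact (integral_toReal (hm.comp (measurable_const_add _)).aemeasurable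
      (ae_of_all _ fun _ => measure_lt_top _ _)).symm
  linarith

theorem variance_log_lebesgueDensity_le (hε : ε < 1) :
    MemLp (fun y => Real.log (lebesgueDensity c.outputDist y)) 2 c.outputDist ∧
    Var[fun y => Real.log (lebesgueDensity c.outputDist y); c.outputDist] ≤
      3 * ((Real.pi * √(n * P)) ^ 2 +
        (2 * (Real.pi * √(n * P) / (1 - ε) - Real.log (1 - ε)) ^ 2 + 4) +
        Var[fun z => ‖z‖ ^ 2; stdGaussian (EuclideanSpace ℝ (Fin n))] / 4) := by
  have := c.isMarkovKernel_decoder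
  -- Two codewords in the ball of radius `√(nP)` are at most one diameter apart; this is where the
  -- power constraint enters.
  have hL : ∀ i j, ‖(c.encoder i : EuclideanSpace ℝ (Fin n)) - c.encoder j‖ ≤
      (2 * Real.toNNReal (√(n * P)) : NNReal) := fun i j => by
    have h1 := norm_sub_le (c.encoder i : EuclideanSpace ℝ (Fin n)) (c.encoder j)
    have h2 := (c.encoder i).2
    have h3 := (c.encoder j).2
    rw [NNReal.coe_mul, Real.coe_toNNReal _ (Real.sqrt_nonneg _), NNReal.coe_ofNat]
    linarith
  obtain ⟨h1, h2⟩ := variance_log_gaussianMixtureDensity_le c.card_pos hL c.decoder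
    (sub_pos.2 hε) c.one_sub_le_integral_decoder
  have hae : (fun y => Real.log (lebesgueDensity c.outputDist y)) =ᵐ[c.outputDist]
      fun y => Real.log (gaussianMixtureDensity
        (fun j => (c.encoder j : EuclideanSpace ℝ (Fin n))) y) := by
    rw [outputDist_eq_gaussianMixture]
    exact (lebesgueDensity_gaussianMixture _ c.card_pos).fun_comp Real.log
  rw [memLp_congr_ae hae, variance_congr hae, outputDist_eq_gaussianMixture]
  refine ⟨h1, h2.trans (le_of_eq ?_)⟩
  rw [NNReal.coe_mul, Real.coe_toNNReal _ (Real.sqrt_nonneg _), NNReal.coe_ofNat]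
  ring_nf

end MaxDetCode

theorem exists_variance_logb_lebesgueDensity_le (b P : ℝ) (hP : 0 < P) (ε : ℝ) (hε1 : ε < 1) :
    ∃ a : ℝ, ∀ (n M : ℕ) (c : MaxDetCode (awgn P n) M ε), 0 < n →
      MemLp (fun y => Real.logb b (lebesgueDensity c.outputDist y)) 2 c.outputDist ∧
      Var[fun y => Real.logb b (lebesgueDensity c.outputDist y); c.outputDist] ≤ a * n := by
  obtain ⟨v, hv, hvar⟩ := exists_variance_norm_sq_stdGaussian
  -- The inner coefficients `4` come from `2 * (u - v) ^ 2 ≤ 4 * u ^ 2 + 4 * v ^ 2`. The terms not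
  -- growing with `n` are absorbed using `1 ≤ n`.
  refine ⟨((Real.log b)⁻¹) ^ 2 * (3 * (Real.pi ^ 2 * P +
    (4 * (Real.pi ^ 2 * P / (1 - ε) ^ 2) + 4 * Real.log (1 - ε) ^ 2 + 4) + v / 4)),
    fun n M c hn => ?_⟩
  obtain ⟨h1, h2⟩ := c.variance_log_lebesgueDensity_le hε1
  have hlogb : ∀ y, Real.logb b (lebesgueDensity c.outputDist y) =
      (Real.log b)⁻¹ * Real.log (lebesgueDensity c.outputDist y) := fun y => by
    rw [Real.logb, div_eq_inv_mul]
  simp_rw [hlogb]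
  refine ⟨h1.const_mul _, ?_⟩
  rw [variance_const_mul, mul_assoc]
  refine mul_le_mul_of_nonneg_left (h2.trans ?_) (sq_nonneg _)
  rw [hvar n, mul_assoc]
  refine mul_le_mul_of_nonneg_left ?_ (by norm_num)
  have hn1 : (1 : ℝ) ≤ n := by exact_mod_cast hn
  have hs : √(n * P) ^ 2 = n * P := Real.sq_sqrt (by positivity)
  have h3 : (Real.pi * √(n * P) / (1 - ε) - Real.log (1 - ε)) ^ 2 ≤
      2 * (n * (Real.pi ^ 2 * P / (1 - ε) ^ 2)) + 2 * Real.log (1 - ε) ^ 2 := by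
    have h4 : (Real.pi * √(n * P) / (1 - ε)) ^ 2 = n * (Real.pi ^ 2 * P / (1 - ε) ^ 2) := by
      rw [div_pow, mul_pow, hs]; ring
    nlinarith [sq_nonneg (Real.pi * √(n * P) / (1 - ε) + Real.log (1 - ε))]
  have h5 : Real.log (1 - ε) ^ 2 ≤ Real.log (1 - ε) ^ 2 * n :=
    le_mul_of_one_le_right (sq_nonneg _) hn1
  rw [mul_pow, hs]
  nlinarith

theorem mainTheorem9 (b : ℝ) (hb : 1 < b) (P : ℝ) (hP : 0 < P) (ε : ℝ) (hε0 : 0 ≤ ε)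
    (hε1 : ε < 1) :
    ∃ a : ℝ, ∀ (M : ℕ → ℕ) (c : ∀ n : ℕ, MaxDetCode (awgn P n) (M n) ε),
      (∀ᶠ n : ℕ in atTop,
        MemLp (fun y => Real.logb b (lebesgueDensity (c n).outputDist y)) 2 (c n).outputDist ∧
        Var[fun y => Real.logb b (lebesgueDensity (c n).outputDist y); (c n).outputDist]
          ≤ a * n) ∧
      (fun n : ℕ =>
        Var[fun y => Real.logb b (lebesgueDensity (c n).outputDist y); (c n).outputDist])
        =o[atTop] (fun n : ℕ => (n : ℝ) ^ 2) := by
  obtain ⟨a, ha⟩ := exists_variance_logb_lebesgueDensity_le b P hP ε hε1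
  refine ⟨a, fun M c => ?_⟩
  have h : ∀ᶠ n : ℕ in atTop,
      MemLp (fun y => Real.logb b (lebesgueDensity (c n).outputDist y)) 2 (c n).outputDist ∧
      Var[fun y => Real.logb b (lebesgueDensity (c n).outputDist y); (c n).outputDist] ≤ a * n :=
    -- The bound is uniform over codes and message counts, so "sufficiently large" excludes only `n
    -- = 0`.
    (eventually_gt_atTop 0).mono fun n hn => ha n (M n) (c n) hn
  refine ⟨h, ?_⟩
  have h1 : (fun n : ℕ =>
      Var[fun y => Real.logb b (lebesgueDensity (c n).outputDist y); (c n).outputDist])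
      =O[atTop] fun n : ℕ => (n : ℝ) := by
    refine IsBigO.of_bound a (h.mono fun n hn => ?_)
    rw [Real.norm_of_nonneg (variance_nonneg _ _), Real.norm_of_nonneg (Nat.cast_nonneg n)]
    exact hn.2
  refine h1.trans_isLittleO ?_
  have h2 := (isLittleO_pow_pow_atTop_of_lt (𝕜 := ℝ) one_lt_two).comp_tendsto
    tendsto_natCast_atTop_atTop
  simpa [Function.comp_def] using h2
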